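/- **Setting.** Let $\mathcal X,\mathcal Y$ be nonempty finite or countable alphabets. A channel is a Markov kernel $x\mapsto \Pr(\,\cdot\mid x)$ from $\mathcal X^{\mathbb Z}$ to $\mathcal Y^{\mathbb Z}$. It is causal if for all $t\in\mathbb Z$, $L\ge 0$ the law of the output block $Y_{t:t+L}=Y_t\dots Y_{t+L-1}$ given the input sequence $x$ depends only on $(x_i)_{i<t+L}$. An input process is a probability measure $\mu$ on $\mathcal X^{\mathbb Z}$; together with the channel it determines a joint law $P_\mu$ of $(X_t,Y_t)_{t\in\mathbb Z}$. The joint past is $\overleftarrow Z=(X_t,Y_t)_{t<0}$; the input and output futures are $\overrightarrow X=(X_t)_{t\ge 0}$ and $\overrightarrow Y=(Y_t)_{t\ge 0}$. *Causal states.* For a causal channel, disintegrating the law of (output past, $Y_{0:L}$) given (input past, $X_{0:L}=w$) along the output past gives the future morph of a joint past $z$, the family of laws $\Pr(Y_{0:L}\in\cdot\mid X_{0:L}=w,\overleftarrow Z=z)$, $L\ge 0$, $w\in\mathcal X^L$. It does not involve an input process, and, for every $\mu$, it is determined for $P_\mu$-almost every $z$. Fix any version of it. Two joint pasts are causally equivalent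 if they have the same future morph; the equivalence classes are the causal states. *Prescient rivals.* A rival is a measurable map $\eta$ from joint pasts to an arbitrary measurable space $S$; its states are the sets $\eta^{-1}(s)$, $s \in S$. It is prescient for $\mu$ if, under $P_\mu$, $$I[\eta(\overleftarrow Z);\overrightarrow Y\mid\overrightarrow X]=I[\overleftarrow Z;\overrightarrow Y\mid\overrightarrow X]<\infty,$$ or if $$I[\eta(\overleftarrow Z);Y_{0:L}\mid\overrightarrow X]=I[\overleftarrow Z;Y_{0:L}\mid\overrightarrow X]<\infty\quad\text{for every }L\ge 0$$ (finiteness in the second condition is automatic if $\mathcal Y$ is finite). *Refinement.* The rival refines the causal-state partition $\mu$-almost everywhere if there is a set $N$ of joint pasts with $P_\mu(\overleftarrow Z\in N)=0$ such that, for every $s\in S$, the set $\eta^{-1}(s)\setminus N$ is contained in a single causal state. **Lemma (Refinement).** Let a causal channel and a rival $\eta$ be given. 1. Let $\mu$ be an input process under which every finite input word has positive probability, $\mu(X_{0:L}=w)>0$ for all $L\ge 0$ and $w\in\mathcal X^L$, and for which the product of the laws of the input past and of the input future is absolutely continuous with respect to their joint law. If $\eta$ is prescient for $\mu$, then $\eta$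 refines the causal-state partition $\mu$-almost everywhere. 2. If $\eta$ is prescient for every input process, then, for every input process $\mu$, $\eta$ refines the causal-state partition $\mu$-almost everywhere. -/

import Mathlib

open MeasureTheory ProbabilityTheory
open scoped ENNReal

namespace Transducer

noncomputable section

/-! ### Sequences -/

/-- The past `… s₋₂ s₋₁` of a bi-infinite sequence, read backwards: entry `n` is `s₋₍ₙ₊₁₎`. -/
def past {A : Type*} (s : ℤ → A) : ℕ → A := fun n => s (Int.negSucc n)

/-- The future `s₀ s₁ …` of a bi-infinite sequence. -/
def future {A : Type*} (s : ℤ → A) : ℕ → A := fun n => s (n : ℤ)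

/-- The block `s_{t : t + L} = s_t … s_{t+L-1}`. -/
def window {A : Type*} (t : ℤ) (L : ℕ) (s : ℤ → A) : Fin L → A := fun i => s (t + (i : ℕ))

/-- The bi-infinite sequence with a given past and a given future. -/
def glue {A : Type*} (a u : ℕ → A) : ℤ → A
  | Int.ofNat n => u n
  | Int.negSucc n => a n

/-- A one-sided sequence that begins with the word `w` (continued by a fixed symbol). -/
def extend {A : Type*} [Nonempty A] {L : ℕ} (w : Fin L → A) : ℕ → A :=
  fun n => if h : n < L then w ⟨n, h⟩ else Classical.arbitrary A

theorem measurable_past {A : Type*} [MeasurableSpace A] :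
    Measurable (past : (ℤ → A) → ℕ → A) :=
  measurable_pi_lambda _ fun _ => measurable_pi_apply _

theorem measurable_future {A : Type*} [MeasurableSpace A] :
    Measurable (future : (ℤ → A) → ℕ → A) :=
  measurable_pi_lambda _ fun _ => measurable_pi_apply _

theorem measurable_window {A : Type*} [MeasurableSpace A] (t : ℤ) (L : ℕ) :
    Measurable (window t L : (ℤ → A) → Fin L → A) :=
  measurable_pi_lambda _ fun _ => measurable_pi_apply _

theorem measurable_glue_extend {A : Type*} [MeasurableSpace A] [Nonempty A] (L : ℕ) :
    Measurable (fun p : (ℕ → A) × (Fin L → A) => glue p.1 (extend p.2)) := by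
  refine measurable_pi_lambda _ fun i => ?_
  cases i with
  | ofNat n =>
    by_cases h : n < L
    · have : (fun p : (ℕ → A) × (Fin L → A) => glue p.1 (extend p.2) (Int.ofNat n))
          = fun p => p.2 ⟨n, h⟩ := by
        funext p; simp [glue, extend, h]
      rw [this]
      exact (measurable_pi_apply _).comp measurable_snd
    · have : (fun p : (ℕ → A) × (Fin L → A) => glue p.1 (extend p.2) (Int.ofNat n))
          = fun _ => Classical.arbitrary A := by
        funext p; simp [glue, extend, h]
      rw [this]
      exact measurable_const
  | negSucc n => exact (measurable_pi_apply n).comp measurable_fst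

/-! ### Channels and their causal states

A channel with input alphabet `X` and output alphabet `Y` is a Markov kernel from bi-infinite
input sequences to bi-infinite output sequences. An input process is a probability measure `μ`
on `ℤ → X`, and the joint (input-output) process is `μ ⊗ₘ κ`. -/

section Channel

variable {X Y : Type*} [MeasurableSpace X] [MeasurableSpace Y]

/-- A channel is causal (anticipation-free) if the law of the output block `Y_{t : t + L}` depends
on the input sequence only through the inputs at times before `t + L`. -/
def IsCausal (κ : Kernel (ℤ → X) (ℤ → Y)) : Prop :=
  ∀ (t : ℤ) (L : ℕ) (x x' : ℤ → X), (∀ i < t + L, x i = x' i) →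
    (κ x).map (window t L) = (κ x').map (window t L)

/-- Joint input-output pasts: (input past, output past). -/
abbrev JointPast (X Y : Type*) : Type _ := (ℕ → X) × (ℕ → Y)

/-- The joint past of a pair of bi-infinite input and output sequences. -/
def jointPast (ω : (ℤ → X) × (ℤ → Y)) : JointPast X Y := (past ω.1, past ω.2)

/-- The law of (output past, output word of length `L`) as a function of (input past, input word
of length `L`). For a causal channel the symbols that continue the input are irrelevant. -/
def wordChannel [Nonempty X] (κ : Kernel (ℤ → X) (ℤ → Y)) (L : ℕ) :
    Kernel ((ℕ → X) × (Fin L → X)) ((ℕ → Y) × (Fin L → Y)) :=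
  (κ.comap (fun p => glue p.1 (extend p.2)) (measurable_glue_extend L)).map
    (fun y => (past y, window 0 L y))

instance [Nonempty X] (κ : Kernel (ℤ → X) (ℤ → Y)) [IsMarkovKernel κ] (L : ℕ) :
    IsMarkovKernel (wordChannel κ L) :=
  Kernel.IsMarkovKernel.map _ (measurable_past.prodMk (measurable_window 0 L))

variable [Countable X] [Countable Y] [DiscreteMeasurableSpace X] [DiscreteMeasurableSpace Y]
  [Nonempty X] [Nonempty Y]

/-- The future morph of a joint past `z`: the conditional law of the next `L` outputs given that
the joint past is `z` and that the next `L` inputs are `w`,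
`Pr(Y_{0:L} ∈ · | X_{0:L} = w, past = z)`, obtained by disintegrating the channel along the output
past. It does not involve any input process. -/
def futureMorph (κ : Kernel (ℤ → X) (ℤ → Y)) [IsMarkovKernel κ] (z : JointPast X Y)
    (L : ℕ) (w : Fin L → X) : Measure (Fin L → Y) :=
  (wordChannel κ L).condKernel ((z.1, w), z.2)

/-- The causal equivalence relation: two joint pasts are equivalent if they have the same future
morph, that is, if they assign the same probabilities to all finite future output words given
every finite future input word. -/
def causalEquiv (κ : Kernel (ℤ → X) (ℤ → Y)) [IsMarkovKernel κ] : Setoid (JointPast X Y) where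
  r z z' := ∀ (L : ℕ) (w : Fin L → X), futureMorph κ z L w = futureMorph κ z' L w
  iseqv := ⟨fun _ _ _ => rfl, fun h L w => (h L w).symm, fun h h' L w => (h L w).trans (h' L w)⟩

/-- The causal states of a channel: the causal equivalence classes of joint pasts. -/
def CausalState (κ : Kernel (ℤ → X) (ℤ → Y)) [IsMarkovKernel κ] : Type _ :=
  Quotient (causalEquiv κ)

/-- The ε-map, sending a joint past to its causal state. -/
def epsilonMap (κ : Kernel (ℤ → X) (ℤ → Y)) [IsMarkovKernel κ] (z : JointPast X Y) :
    CausalState κ :=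
  Quotient.mk (causalEquiv κ) z

end Channel

/-! ### Prescience -/

/-- Conditional mutual information `I[A ; B | C] = D(P_{ACB} ‖ P_{AC} ⊗ P_{B|C})`. -/
def condMutualInfo {Ω α β γ : Type*} [MeasurableSpace Ω] [MeasurableSpace α] [MeasurableSpace β]
    [MeasurableSpace γ] [StandardBorelSpace β] [Nonempty β] (P : Measure Ω) [IsFiniteMeasure P]
    (A : Ω → α) (B : Ω → β) (C : Ω → γ) : ℝ≥0∞ :=
  InformationTheory.klDiv (P.map fun ω => ((A ω, C ω), B ω))
    ((P.map fun ω => (A ω, C ω)) ⊗ₘ ((condDistrib B C P).comap Prod.snd measurable_snd))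

section Prescience

variable {X Y : Type*} [MeasurableSpace X] [MeasurableSpace Y]
  [Countable Y] [DiscreteMeasurableSpace Y] [Nonempty Y]
  {S : Type*} [MeasurableSpace S]

/-- The prescience `I[η(past) ; Y_{0:∞} | X_{0:∞}]` of the states `η(past)`. -/
def prescience (κ : Kernel (ℤ → X) (ℤ → Y)) [IsMarkovKernel κ] (μ : Measure (ℤ → X))
    [IsProbabilityMeasure μ] (η : JointPast X Y → S) : ℝ≥0∞ :=
  condMutualInfo (μ ⊗ₘ κ) (fun ω => η (jointPast ω)) (fun ω => future ω.2) (fun ω => future ω.1)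

/-- The finite-length prescience `I[η(past) ; Y_{0:L} | X_{0:∞}]`. -/
def finitePrescience (κ : Kernel (ℤ → X) (ℤ → Y)) [IsMarkovKernel κ] (μ : Measure (ℤ → X))
    [IsProbabilityMeasure μ] (L : ℕ) (η : JointPast X Y → S) : ℝ≥0∞ :=
  condMutualInfo (μ ⊗ₘ κ) (fun ω => η (jointPast ω)) (fun ω => window 0 L ω.2)
    (fun ω => future ω.1)

/-- The rival states `η(past)` are prescient for the input process `μ` if they carry as much
information about the future output, given the future input, as the joint past itself does. This
is an equality between finite amounts of information: either for the whole output future, or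
(when that amount may be infinite) for the output words of every finite length. -/
def IsPrescient (κ : Kernel (ℤ → X) (ℤ → Y)) [IsMarkovKernel κ] (μ : Measure (ℤ → X))
    [IsProbabilityMeasure μ] (η : JointPast X Y → S) : Prop :=
  (prescience κ μ (id : JointPast X Y → JointPast X Y) ≠ ∞ ∧
      prescience κ μ η = prescience κ μ (id : JointPast X Y → JointPast X Y)) ∨
    ∀ L : ℕ, finitePrescience κ μ L (id : JointPast X Y → JointPast X Y) ≠ ∞ ∧
      finitePrescience κ μ L η = finitePrescience κ μ L (id : JointPast X Y → JointPast X Y)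

end Prescience

/-- An input process drives every past with every kind of future: each finite input word has
positive probability, and the past and the future input are not locked to each other, in the
sense that the product of their laws is absolutely continuous with respect to their joint law. -/
structure IsNondegenerateInput {X : Type*} [MeasurableSpace X] (μ : Measure (ℤ → X)) : Prop where
  word_pos : ∀ (L : ℕ) (w : Fin L → X), 0 < μ {x | window 0 L x = w}
  prod_ac : (μ.map past).prod (μ.map future) ≪ μ.map fun x => (past x, future x)

/-- The partition of joint pasts induced by `η` refines, almost everywhere for the input process
`μ`, the causal-state partition: outside a set of joint pasts of probability zero, every rival
state `η ⁻¹' {s}` is contained in a single causal state. -/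
def RefinesCausalStatesAE {X Y : Type*} [MeasurableSpace X] [MeasurableSpace Y]
    [Countable X] [Countable Y] [DiscreteMeasurableSpace X] [DiscreteMeasurableSpace Y]
    [Nonempty X] [Nonempty Y] {S : Type*}
    (κ : Kernel (ℤ → X) (ℤ → Y)) [IsMarkovKernel κ] (μ : Measure (ℤ → X))
    (η : JointPast X Y → S) : Prop :=
  ∃ N : Set (JointPast X Y), (μ ⊗ₘ κ).map jointPast N = 0 ∧
    ∀ s : S, ∃ σ : CausalState κ, ∀ z ∉ N, η z = s → epsilonMap κ z = σ

end

end Transducer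

/-! Prescience is equality in a data processing inequality. The mutual information given the input
future is a divergence, and passing from the joint past to the rival state is a map that loses none
of it. Finite divergence makes equality rigid: the density factors through the map
(`eq_withDensity_of_klDiv_map_eq`). Hence the law of an output word given joint past and input
future depends, almost surely, only on rival state and input future. By causality the future morph
is also a version of this law, so the two agree almost everywhere under the joint law of joint past
and input future.

Absolute continuity moves this agreement to the product law (`IsCausal.prod_jointPast_future_ac`).
By Fubini, almost every joint past then satisfies it for almost every input future. Two such pasts
with the same rival state share a good future beginning with any given word, because the word has
positive probability; so their morphs coincide.

For the second claim, the law of the joint past depends on the input process only through the input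
past (`IsCausal.map_jointPast`). The future may therefore be replaced by an independent one charging
every word. -/

namespace Transducer

/-! ### Equality in data processing, and conditional mutual information -/

/-- Equality in the data processing inequality for the Kullback-Leibler divergence: if the map `φ`
loses no divergence, then the density of `m` with respect to `n` factors through `φ`. -/
theorem eq_withDensity_of_klDiv_map_eq {α β : Type*} [MeasurableSpace α] [MeasurableSpace β]
    {m n : Measure α} [IsFiniteMeasure m] [IsFiniteMeasure n] {φ : α → β} (hφ : Measurable φ)
    (hfin : InformationTheory.klDiv m n ≠ ∞)
    (heq : InformationTheory.klDiv (m.map φ) (n.map φ) = InformationTheory.klDiv m n) :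
    m = n.withDensity fun x => (m.map φ).rnDeriv (n.map φ) (φ x) := by
  obtain ⟨hmn, hint⟩ := InformationTheory.klDiv_ne_top_iff.1 hfin
  obtain ⟨hmn', hint'⟩ := InformationTheory.klDiv_ne_top_iff.1 (heq ▸ hfin)
  set g : β → ℝ≥0∞ := (m.map φ).rnDeriv (n.map φ) with hg
  have hgm : Measurable g := Measure.measurable_rnDeriv _ _
  have hgφ : Measurable fun x => g (φ x) := hgm.comp hφ
  -- Equal total masses: the mass terms in `klDiv` must cancel below.
  have huniv : (n.withDensity fun x => g (φ x)) Set.univ = m Set.univ := by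
    rw [withDensity_apply _ .univ, setLIntegral_univ, ← lintegral_map hgm hφ,
      Measure.lintegral_rnDeriv hmn', Measure.map_apply hφ .univ, Set.preimage_univ]
  have : IsFiniteMeasure (n.withDensity fun x => g (φ x)) :=
    ⟨by rw [huniv]; exact measure_lt_top _ _⟩
  have hpos : ∀ᵐ x ∂m, 0 < g (φ x) := ae_of_ae_map hφ.aemeasurable (Measure.rnDeriv_pos hmn')
  have hlt : ∀ᵐ x ∂m, g (φ x) < ∞ :=
    ae_of_ae_map hφ.aemeasurable (hmn'.ae_le (Measure.rnDeriv_lt_top _ _))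
  have hac : m ≪ n.withDensity fun x => g (φ x) := by
    refine Measure.AbsolutelyContinuous.mk fun s hs h0 => ?_
    rw [withDensity_apply _ hs, setLIntegral_eq_zero_iff hs hgφ] at h0
    rw [measure_eq_zero_iff_ae_notMem]
    filter_upwards [hmn.ae_le h0, hpos] with x hx hx' hxs
    exact hx'.ne' (hx hxs)
  -- By the chain rule for densities this divergence is D(m ‖ n) − D(φm ‖ φn), which vanishes by
  -- `heq`; zero divergence forces equality of the measures.
  have hllr : InformationTheory.klDiv m (n.withDensity fun x => g (φ x)) = 0 := by
    have hl : llr m (n.withDensity fun x => g (φ x))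
        =ᵐ[m] fun x => llr m n x - llr (m.map φ) (n.map φ) (φ x) := by
      filter_upwards [hmn.ae_le (Measure.rnDeriv_mul_rnDeriv (κ := n) hac),
        hmn.ae_le (Measure.rnDeriv_withDensity n hgφ), hpos, hlt,
        Measure.rnDeriv_pos hac, hac.ae_le (Measure.rnDeriv_lt_top m _)]
        with x h1 h2 h3 h4 h5 h6
      simp only [llr]
      rw [← h1, Pi.mul_apply, h2, ENNReal.toReal_mul, Real.log_mul
        (ENNReal.toReal_pos h5.ne' h6.ne).ne' (ENNReal.toReal_pos h3.ne' h4.ne).ne']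
      simp [hg]
    have hi : Integrable (fun x => llr (m.map φ) (n.map φ) (φ x)) m :=
      (integrable_map_measure hint'.1 hφ.aemeasurable).1 hint'
    rw [InformationTheory.klDiv_of_ac_of_integrable hac ((integrable_congr hl).2 (hint.sub hi)),
      integral_congr_ae hl, integral_sub hint hi]
    have e1 := InformationTheory.toReal_klDiv hmn hint
    have e2 := InformationTheory.toReal_klDiv hmn' hint'
    rw [heq, integral_map hφ.aemeasurable hint'.1] at e2
    simp only [Measure.real, huniv, Measure.map_apply hφ .univ, Set.preimage_univ] at e1 e2 ⊢
    rw [ENNReal.ofReal_eq_zero]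
    linarith
  exact InformationTheory.klDiv_eq_zero_iff.1 hllr

/-- If `f ∘ A` carries as much information about `B` given `C` as `A` does, then the conditional
probability of an event of `B` given `A` and `C` is a function of `f ∘ A` and `C`. -/
theorem exists_measure_eq_setLIntegral_of_condMutualInfo_eq {Ω α β γ S : Type*}
    [MeasurableSpace Ω] [MeasurableSpace α] [MeasurableSpace β] [MeasurableSpace γ]
    [MeasurableSpace S] [StandardBorelSpace β] [Nonempty β] {P : Measure Ω} [IsFiniteMeasure P]
    {A : Ω → α} {B : Ω → β} {C : Ω → γ} {f : α → S} (hA : Measurable A) (hB : Measurable B)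
    (hC : Measurable C) (hf : Measurable f) (hfin : condMutualInfo P A B C ≠ ∞)
    (heq : condMutualInfo P (fun ω => f (A ω)) B C = condMutualInfo P A B C)
    {E : Set β} (hE : MeasurableSet E) :
    ∃ h : S × γ → ℝ≥0∞, Measurable h ∧ ∀ D : Set (α × γ), MeasurableSet D →
      P {ω | (A ω, C ω) ∈ D ∧ B ω ∈ E}
        = ∫⁻ p in D, h (f p.1, p.2) ∂(P.map fun ω => (A ω, C ω)) := by
  unfold condMutualInfo at hfin heq
  set k : Kernel γ β := condDistrib B C P
  have hψ : Measurable fun p : α × γ => (f p.1, p.2) := by fun_prop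
  have hφ : Measurable fun q : (α × γ) × β => ((f q.1.1, q.1.2), q.2) := by fun_prop
  have hm : (P.map fun ω => ((A ω, C ω), B ω)).map (fun q => ((f q.1.1, q.1.2), q.2))
      = P.map fun ω => ((f (A ω), C ω), B ω) := by
    rw [Measure.map_map hφ (by fun_prop)]
    rfl
  -- The reference measure is compatible with `f` because its kernel sees only the `γ`-coordinate.
  have hn : ((P.map fun ω => (A ω, C ω)) ⊗ₘ (k.comap Prod.snd measurable_snd)).map
        (fun q => ((f q.1.1, q.1.2), q.2))
      = (P.map fun ω => (f (A ω), C ω)) ⊗ₘ (k.comap Prod.snd measurable_snd) := by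
    ext s hs
    have hfA : (P.map fun ω => (f (A ω), C ω))
        = (P.map fun ω => (A ω, C ω)).map (fun p => (f p.1, p.2)) := by
      rw [Measure.map_map hψ (by fun_prop)]
      rfl
    rw [Measure.map_apply hφ hs, Measure.compProd_apply (hφ hs), Measure.compProd_apply hs, hfA,
      lintegral_map (Kernel.measurable_kernel_prodMk_left hs) hψ]
    rfl
  rw [← hm, ← hn] at heq
  have key := eq_withDensity_of_klDiv_map_eq hφ hfin heq
  rw [hm, hn] at key
  set g : (S × γ) × β → ℝ≥0∞ := (P.map fun ω => ((f (A ω), C ω), B ω)).rnDeriv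
    ((P.map fun ω => (f (A ω), C ω)) ⊗ₘ (k.comap Prod.snd measurable_snd))
  have hg : Measurable g := Measure.measurable_rnDeriv _ _
  let k' : Kernel (S × γ) β := k.comap Prod.snd measurable_snd
  -- Integrating the factored density over `E` against the law of `B` given `C` yields the
  -- conditional probability of `E`.
  refine ⟨fun p => ∫⁻ b in E, g (p, b) ∂(k' p), ?_, fun D hD => ?_⟩
  · exact Measurable.setLIntegral_kernel_prod_right (f := fun p b => g (p, b)) hg hE
  · have : P {ω | (A ω, C ω) ∈ D ∧ B ω ∈ E} = (P.map fun ω => ((A ω, C ω), B ω)) (D ×ˢ E) := by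
      rw [Measure.map_apply (by fun_prop) (hD.prod hE)]
      rfl
    rw [this, key, withDensity_apply _ (hD.prod hE)]
    exact Measure.setLIntegral_compProd (hg.comp hφ) hD hE

/-! ### Gluing a past to a future -/

theorem past_glue {A : Type*} (a u : ℕ → A) : past (glue a u) = a := rfl

theorem future_glue {A : Type*} (a u : ℕ → A) : future (glue a u) = u := rfl

theorem measurable_glue {A : Type*} [MeasurableSpace A] :
    Measurable fun p : (ℕ → A) × (ℕ → A) => glue p.1 p.2 := by
  refine measurable_pi_lambda _ fun i => ?_
  cases i with
  | ofNat n => exact (measurable_pi_apply n).comp measurable_snd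
  | negSucc n => exact (measurable_pi_apply n).comp measurable_fst

theorem window_zero_eq {A : Type*} (L : ℕ) (x : ℤ → A) :
    window 0 L x = fun i : Fin L => future x i := by
  funext i
  simp [window, future]

theorem glue_past_extend_window {A : Type*} [Nonempty A] (L : ℕ) (x : ℤ → A) {i : ℤ}
    (hi : i < L) : glue (past x) (extend (window 0 L x)) i = x i := by
  cases i with
  | ofNat n =>
    have hn : n < L := by simpa using hi
    simp [glue, extend, hn, window]
  | negSucc n => rfl

/-! ### Consequences of causality -/

section Causal

variable {X Y : Type*} [MeasurableSpace X] [MeasurableSpace Y]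

theorem measurable_jointPast :
    Measurable (jointPast : (ℤ → X) × (ℤ → Y) → JointPast X Y) :=
  (measurable_past.comp measurable_fst).prodMk (measurable_past.comp measurable_snd)

/-- For a causal channel, the joint law of the output past and of the output word of length `L`
depends only on the inputs at times before `L`. -/
theorem IsCausal.map_past_window_congr {κ : Kernel (ℤ → X) (ℤ → Y)} [IsMarkovKernel κ]
    (hκ : IsCausal κ) {L : ℕ} {x x' : ℤ → X} (h : ∀ i < (L : ℤ), x i = x' i) :
    (κ x).map (fun y => (past y, window 0 L y)) = (κ x').map (fun y => (past y, window 0 L y)) := by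
  -- The output read backwards from time `L - 1`. It encodes past and word together, and each of its
  -- finite marginals is a function of one window ending at `L`, to which causality applies.
  let r : (ℤ → Y) → ℕ → Y := fun y n => y (L - 1 - n)
  have hr : Measurable r := measurable_pi_lambda _ fun _ => measurable_pi_apply _
  let p : (ℕ → Y) → (ℕ → Y) × (Fin L → Y) := fun s => (fun n => s (L + n), fun i => s (L - 1 - i))
  have hp : Measurable p := by fun_prop
  have hpr : (fun y : ℤ → Y => (past y, window 0 L y)) = p ∘ r := by
    funext y
    refine Prod.ext (funext fun n => ?_) (funext fun i => ?_)
    · simp only [past, p, r, Function.comp]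
      congr 1
      rw [Int.negSucc_eq]
      push_cast
      ring
    · simp only [window, p, r, Function.comp]
      congr 1
      have := i.2
      omega
  have key : (κ x).map r = (κ x').map r := by
    have : ∀ I : Finset ℕ, ((κ x).map r).map I.restrict = ((κ x').map r).map I.restrict := by
      intro I
      obtain ⟨N, hN⟩ : ∃ N : ℕ, ∀ n ∈ I, n < N :=
        ⟨I.sup id + 1, fun n hn => Nat.lt_succ_of_le (Finset.le_sup (f := id) hn)⟩
      let q : (Fin N → Y) → (I → Y) := fun v n => v ⟨N - 1 - n, by have := hN n n.2; omega⟩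
      have hq : Measurable q := by fun_prop
      have hqr : I.restrict ∘ r = q ∘ window (L - N : ℤ) N := by
        funext y n
        simp only [Finset.restrict, r, q, window, Function.comp]
        congr 1
        have := hN n n.2
        omega
      have hI : Measurable (I.restrict : (ℕ → Y) → I → Y) := by fun_prop
      rw [Measure.map_map hI hr, Measure.map_map hI hr, hqr,
        ← Measure.map_map hq (measurable_window _ _), ← Measure.map_map hq (measurable_window _ _),
        hκ (L - N : ℤ) N x x' fun i hi => h i (by omega)]
    have : IsProbabilityMeasure ((κ x').map r) := Measure.isProbabilityMeasure_map hr.aemeasurable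
    have : IsProbabilityMeasure ((κ x).map r) := Measure.isProbabilityMeasure_map hr.aemeasurable
    exact IsProjectiveLimit.unique (P := fun I => ((κ x').map r).map I.restrict) ‹_› fun I => rfl
  rw [hpr, ← Measure.map_map hp hr, ← Measure.map_map hp hr, key]

theorem IsCausal.map_past_window_eq_wordChannel [Nonempty X] {κ : Kernel (ℤ → X) (ℤ → Y)}
    [IsMarkovKernel κ] (hκ : IsCausal κ) (L : ℕ) (x : ℤ → X) :
    (κ x).map (fun y => (past y, window 0 L y))
      = wordChannel κ L (past x, window 0 L x) := by
  rw [wordChannel, Kernel.map_apply _ (measurable_past.prodMk (measurable_window 0 L)),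
    Kernel.comap_apply]
  exact hκ.map_past_window_congr fun i hi => (glue_past_extend_window L x hi).symm

/-- The law of the output past as a function of the input past. -/
noncomputable def pastChannel [Nonempty X] (κ : Kernel (ℤ → X) (ℤ → Y)) :
    Kernel (ℕ → X) (ℕ → Y) :=
  (κ.comap (fun a => glue a fun _ => Classical.arbitrary X)
    (measurable_glue.comp (measurable_id.prodMk measurable_const))).map past

instance [Nonempty X] (κ : Kernel (ℤ → X) (ℤ → Y)) [IsMarkovKernel κ] :
    IsMarkovKernel (pastChannel κ) :=
  Kernel.IsMarkovKernel.map _ measurable_past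

theorem IsCausal.map_past_eq_pastChannel [Nonempty X] {κ : Kernel (ℤ → X) (ℤ → Y)}
    [IsMarkovKernel κ] (hκ : IsCausal κ) (x : ℤ → X) :
    (κ x).map past = pastChannel κ (past x) := by
  -- With `L = 0` the word is empty and only the inputs before time 0 matter.
  have h := hκ.map_past_window_congr (L := 0) (x := x)
    (x' := glue (past x) fun _ => Classical.arbitrary X) fun i hi => by
      cases i with
      | ofNat n => simp at hi; omega
      | negSucc n => rfl
  have h' := congrArg (Measure.map Prod.fst) h
  have hm : Measurable fun y : ℤ → Y => (past y, window 0 0 y) :=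
    measurable_past.prodMk (measurable_window 0 0)
  rw [Measure.map_map measurable_fst hm, Measure.map_map measurable_fst hm] at h'
  rw [pastChannel, Kernel.map_apply _ measurable_past, Kernel.comap_apply]
  exact h'

/-- The law of the joint past depends only on the law of the input past. -/
theorem IsCausal.map_jointPast [Nonempty X] {κ : Kernel (ℤ → X) (ℤ → Y)}
    [IsMarkovKernel κ] (hκ : IsCausal κ) (μ : Measure (ℤ → X)) [SFinite μ] :
    (μ ⊗ₘ κ).map jointPast = (μ.map past) ⊗ₘ pastChannel κ := by
  ext s hs
  rw [Measure.map_apply measurable_jointPast hs,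
    Measure.compProd_apply (measurable_jointPast hs), Measure.compProd_apply hs,
    lintegral_map (Kernel.measurable_kernel_prodMk_left hs) measurable_past]
  refine lintegral_congr fun x => ?_
  rw [← hκ.map_past_eq_pastChannel, Measure.map_apply measurable_past (measurable_prodMk_left hs)]
  rfl

/-- If the product of the laws of the input past and of the input future is absolutely continuous
with respect to their joint law, then so it is with the joint past in place of the input past. -/
theorem IsCausal.prod_jointPast_future_ac [Nonempty X] {κ : Kernel (ℤ → X) (ℤ → Y)}
    [IsMarkovKernel κ] (hκ : IsCausal κ) {μ : Measure (ℤ → X)} [IsProbabilityMeasure μ]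
    (hμ : (μ.map past).prod (μ.map future) ≪ μ.map fun x => (past x, future x)) :
    ((μ ⊗ₘ κ).map jointPast).prod (μ.map future)
      ≪ (μ ⊗ₘ κ).map fun ω => (jointPast ω, future ω.1) := by
  have hpf : Measurable fun x : ℤ → X => (past x, future x) :=
    measurable_past.prodMk measurable_future
  have hjf : Measurable fun ω : (ℤ → X) × (ℤ → Y) => (jointPast ω, future ω.1) :=
    measurable_jointPast.prodMk (measurable_future.comp measurable_fst)
  refine Measure.AbsolutelyContinuous.mk fun s hs h0 => ?_
  -- The output past is put last: given both input halves, its law depends only on the input past,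
  -- so the section probabilities are functions of (past, future) and their vanishing transfers
  -- along `hμ`.
  let T : Set (((ℕ → X) × (ℕ → X)) × (ℕ → Y)) := {p | ((p.1.1, p.2), p.1.2) ∈ s}
  have hT : MeasurableSet T := hs.preimage (by fun_prop)
  let q : Kernel ((ℕ → X) × (ℕ → X)) (ℕ → Y) := (pastChannel κ).comap Prod.fst measurable_fst
  have hF : Measurable fun p => q p (Prod.mk p ⁻¹' T) := Kernel.measurable_kernel_prodMk_left hT
  have h1 : ∫⁻ p, q p (Prod.mk p ⁻¹' T) ∂(μ.map fun x => (past x, future x)) = 0 := by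
    rw [lintegral_map hF hpf, ← h0, Measure.map_apply hjf hs, Measure.compProd_apply (hjf hs)]
    refine lintegral_congr fun x => ?_
    simp only [q, Kernel.comap_apply]
    rw [← hκ.map_past_eq_pastChannel,
      Measure.map_apply measurable_past (measurable_prodMk_left hT)]
    rfl
  rw [lintegral_eq_zero_iff hF] at h1
  have h2 : ∫⁻ p, q p (Prod.mk p ⁻¹' T) ∂((μ.map past).prod (μ.map future)) = 0 :=
    (lintegral_eq_zero_iff hF).2 (hμ.ae_le h1)
  have : IsProbabilityMeasure (μ.map past) :=
    Measure.isProbabilityMeasure_map measurable_past.aemeasurable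
  have : IsProbabilityMeasure (μ.map future) :=
    Measure.isProbabilityMeasure_map measurable_future.aemeasurable
  rw [← h2, lintegral_prod _ hF.aemeasurable, hκ.map_jointPast, Measure.prod_apply hs,
    Measure.lintegral_compProd (measurable_measure_prodMk_left hs)]
  refine lintegral_congr fun a => ?_
  have hs' : MeasurableSet {p : (ℕ → Y) × (ℕ → X) | ((a, p.1), p.2) ∈ s} :=
    hs.preimage (by fun_prop)
  -- For a fixed input past, Fubini exchanges output past and input future.
  exact (Measure.prod_apply hs').symm.trans (Measure.prod_apply_symm hs')

end Causal

/-! ### The future morph as a conditional law -/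

section Morph

variable {X Y : Type*} [MeasurableSpace X] [MeasurableSpace Y]
  [Countable Y] [DiscreteMeasurableSpace Y] [Nonempty X] [Nonempty Y]

theorem measurable_futureMorph (κ : Kernel (ℤ → X) (ℤ → Y)) [IsMarkovKernel κ] (L : ℕ)
    {E : Set (Fin L → Y)} (hE : MeasurableSet E) :
    Measurable fun p : JointPast X Y × (ℕ → X) => futureMorph κ p.1 L (fun i => p.2 i) E := by
  have : Measurable fun p : JointPast X Y × (ℕ → X) =>
      ((p.1.1, fun i : Fin L => p.2 i), p.1.2) := by fun_prop
  exact ((wordChannel κ L).condKernel.measurable_coe hE).comp this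

/-- The future morph is a conditional law of the next `L` outputs given the joint past and the
input future. -/
theorem IsCausal.measure_eq_setLIntegral_futureMorph {κ : Kernel (ℤ → X) (ℤ → Y)}
    [IsMarkovKernel κ] (hκ : IsCausal κ) (μ : Measure (ℤ → X)) [IsProbabilityMeasure μ] (L : ℕ)
    {E : Set (Fin L → Y)} (hE : MeasurableSet E)
    {D : Set (JointPast X Y × (ℕ → X))} (hD : MeasurableSet D) :
    (μ ⊗ₘ κ) {ω | (jointPast ω, future ω.1) ∈ D ∧ window 0 L ω.2 ∈ E}
      = ∫⁻ p in D, futureMorph κ p.1 L (fun i => p.2 i) E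
          ∂((μ ⊗ₘ κ).map fun ω => (jointPast ω, future ω.1)) := by
  have hjf : Measurable fun ω : (ℤ → X) × (ℤ → Y) => (jointPast ω, future ω.1) :=
    measurable_jointPast.prodMk (measurable_future.comp measurable_fst)
  have hfm := measurable_futureMorph κ L hE
  have hpw : Measurable fun y : ℤ → Y => (past y, window 0 L y) :=
    measurable_past.prodMk (measurable_window 0 L)
  have hleft : MeasurableSet {ω : (ℤ → X) × (ℤ → Y) |
      (jointPast ω, future ω.1) ∈ D ∧ window 0 L ω.2 ∈ E} :=
    (hjf hD).inter (((measurable_window 0 L).comp measurable_snd) hE)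
  rw [← lintegral_indicator hD, lintegral_map (hfm.indicator hD) hjf,
    Measure.compProd_apply hleft]
  refine Eq.trans ?_ (Measure.lintegral_compProd ((hfm.indicator hD).comp hjf)).symm
  refine lintegral_congr fun x => ?_
  set w : Fin L → X := window 0 L x with hw
  have hDx : MeasurableSet {a : ℕ → Y | ((past x, a), future x) ∈ D} := hD.preimage (by fun_prop)
  have hfst : (κ x).map past = (wordChannel κ L).fst (past x, w) := by
    rw [Kernel.fst_apply, ← hκ.map_past_window_eq_wordChannel, Measure.map_map measurable_fst hpw]
    rfl
  have hpiece : Measurable fun a : ℕ → Y => (wordChannel κ L).condKernel ((past x, w), a) E :=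
    ((wordChannel κ L).condKernel.measurable_coe hE).comp measurable_prodMk_left
  calc (κ x) {y | ((past x, past y), future x) ∈ D ∧ window 0 L y ∈ E}
      = ((κ x).map fun y => (past y, window 0 L y))
          ({a | ((past x, a), future x) ∈ D} ×ˢ E) := by
        rw [Measure.map_apply hpw (hDx.prod hE)]
        rfl
    _ = ∫⁻ a in {a | ((past x, a), future x) ∈ D},
          (wordChannel κ L).condKernel ((past x, w), a) E ∂((wordChannel κ L).fst (past x, w)) := by
        rw [hκ.map_past_window_eq_wordChannel]
        conv_lhs => rw [← (wordChannel κ L).disintegrate (wordChannel κ L).condKernel]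
        rw [Kernel.compProd_apply_prod hDx hE]
    _ = ∫⁻ y, _ ∂(κ x) := by
        rw [← hfst, ← lintegral_indicator hDx, lintegral_map (hpiece.indicator hDx) measurable_past]
        refine lintegral_congr fun y => ?_
        simp only [Set.indicator, Set.mem_ofPred_eq, futureMorph, hw, window_zero_eq]
        rfl

end Morph

/-! ### Nondegenerate inputs with a prescribed past -/

/-- A law of one-sided sequences under which every finite word has positive probability. -/
theorem exists_isProbabilityMeasure_word_pos (X : Type*) [MeasurableSpace X] [Countable X]
    [DiscreteMeasurableSpace X] [Nonempty X] :
    ∃ ρ : Measure (ℕ → X), IsProbabilityMeasure ρ ∧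
      ∀ (L : ℕ) (w : Fin L → X), 0 < ρ {u | (fun i : Fin L => u i) = w} := by
  let σ : Measure (ℕ → X) :=
    Measure.sum fun s : (Σ L : ℕ, Fin L → X) => Measure.dirac (extend s.2)
  have hle : ∀ s : (Σ L : ℕ, Fin L → X), Measure.dirac (extend s.2) ≪ σ := fun s =>
    (Measure.le_sum _ s).absolutelyContinuous
  have hne : σ ≠ 0 := fun h0 => by
    have := hle ⟨0, Fin.elim0⟩
    rw [h0, Measure.absolutelyContinuous_zero_iff] at this
    exact (IsProbabilityMeasure.ne_zero _) this
  have : NeZero σ := ⟨hne⟩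
  -- There are countably many words, so `σ` is s-finite and `toFinite` gives a probability measure
  -- with the same null sets.
  refine ⟨σ.toFinite, inferInstance, fun L w => pos_iff_ne_zero.2 fun h0 => ?_⟩
  have h1 := ((hle ⟨L, w⟩).trans (absolutelyContinuous_toFinite σ)) h0
  rw [Measure.dirac_apply_of_mem] at h1
  · exact one_ne_zero h1
  · funext i
    simp [extend]

/-- Every law of the input past is the law of the past of a nondegenerate input process. -/
theorem exists_isNondegenerateInput_map_past_eq {X : Type*} [MeasurableSpace X] [Countable X]
    [DiscreteMeasurableSpace X] [Nonempty X] (μ : Measure (ℤ → X)) [IsProbabilityMeasure μ] :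
    ∃ ν : Measure (ℤ → X), IsProbabilityMeasure ν ∧ IsNondegenerateInput ν ∧
      ν.map past = μ.map past := by
  obtain ⟨ρ, hρ, hpos⟩ := exists_isProbabilityMeasure_word_pos X
  have : IsProbabilityMeasure (μ.map past) :=
    Measure.isProbabilityMeasure_map measurable_past.aemeasurable
  -- Past and future are made independent, so the absolute continuity holds with equality.
  let ν : Measure (ℤ → X) := ((μ.map past).prod ρ).map fun p => glue p.1 p.2
  have hpf : ν.map (fun x => (past x, future x)) = (μ.map past).prod ρ := by
    rw [Measure.map_map (measurable_past.prodMk measurable_future) measurable_glue]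
    exact Measure.map_id
  have hpast : ν.map past = μ.map past := by
    rw [Measure.map_map measurable_past measurable_glue]
    exact Measure.map_fst_prod.trans (by simp)
  have hfuture : ν.map future = ρ := by
    rw [Measure.map_map measurable_future measurable_glue]
    exact Measure.map_snd_prod.trans (by simp)
  refine ⟨ν, Measure.isProbabilityMeasure_map measurable_glue.aemeasurable, ⟨fun L w => ?_, ?_⟩,
    hpast⟩
  · have hr : Measurable fun (u : ℕ → X) (i : Fin L) => u i := by fun_prop
    have h := hpos L w
    rw [← hfuture, Measure.map_apply measurable_future
      (measurableSet_eq_fun hr measurable_const)] at h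
    simp only [window_zero_eq]
    exact h
  · rw [hpf, hpast, hfuture]

/-! ### From prescience to refinement -/

section Refinement

variable {X Y : Type*} [MeasurableSpace X] [MeasurableSpace Y]
  [Countable Y] [DiscreteMeasurableSpace Y] [Nonempty Y] {S : Type*} [MeasurableSpace S]

/-- For a prescient rival, the conditional probability of an output word given the joint past and
the input future is a function of the rival state and the input future. -/
theorem IsPrescient.exists_measure_eq_setLIntegral {κ : Kernel (ℤ → X) (ℤ → Y)} [IsMarkovKernel κ]
    {μ : Measure (ℤ → X)} [IsProbabilityMeasure μ] {η : JointPast X Y → S} (hη : Measurable η)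
    (h : IsPrescient κ μ η) (L : ℕ) {E : Set (Fin L → Y)} (hE : MeasurableSet E) :
    ∃ g : S × (ℕ → X) → ℝ≥0∞, Measurable g ∧
      ∀ D : Set (JointPast X Y × (ℕ → X)), MeasurableSet D →
        (μ ⊗ₘ κ) {ω | (jointPast ω, future ω.1) ∈ D ∧ window 0 L ω.2 ∈ E}
          = ∫⁻ p in D, g (η p.1, p.2) ∂((μ ⊗ₘ κ).map fun ω => (jointPast ω, future ω.1)) := by
  have hX : Measurable fun ω : (ℤ → X) × (ℤ → Y) => future ω.1 :=
    measurable_future.comp measurable_fst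
  rcases h with ⟨hfin, heq⟩ | h
  · have hr : Measurable fun (b : ℕ → Y) (i : Fin L) => b i := by fun_prop
    obtain ⟨g, hg, H⟩ := exists_measure_eq_setLIntegral_of_condMutualInfo_eq
      (A := fun ω : (ℤ → X) × (ℤ → Y) => jointPast ω) measurable_jointPast
      (measurable_future.comp measurable_snd) hX hη hfin heq (hr hE)
    refine ⟨g, hg, fun D hD => ?_⟩
    simp only [window_zero_eq]
    exact H D hD
  · obtain ⟨hfin, heq⟩ := h L
    exact exists_measure_eq_setLIntegral_of_condMutualInfo_eq
      (A := fun ω : (ℤ → X) × (ℤ → Y) => jointPast ω) measurable_jointPast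
      ((measurable_window 0 L).comp measurable_snd) hX hη hfin heq hE

variable [Nonempty X]

/-- A prescient rival determines the future morph, almost surely. -/
theorem IsPrescient.exists_ae_futureMorph_eq {κ : Kernel (ℤ → X) (ℤ → Y)} [IsMarkovKernel κ]
    (hκ : IsCausal κ) {μ : Measure (ℤ → X)} [IsProbabilityMeasure μ] {η : JointPast X Y → S}
    (hη : Measurable η) (h : IsPrescient κ μ η) :
    ∃ g : (L : ℕ) → (Fin L → Y) → S × (ℕ → X) → ℝ≥0∞,
      ∀ᵐ p ∂((μ ⊗ₘ κ).map fun ω => (jointPast ω, future ω.1)), ∀ (L : ℕ) (y : Fin L → Y),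
        futureMorph κ p.1 L (fun i => p.2 i) {y} = g L y (η p.1, p.2) := by
  -- There are countably many pairs `(L, y)`, so a single null set serves all of them.
  choose g hg H using fun (L : ℕ) (y : Fin L → Y) =>
    h.exists_measure_eq_setLIntegral hη L (measurableSet_singleton y)
  refine ⟨g, ae_all_iff.2 fun L => ae_all_iff.2 fun y => ?_⟩
  refine ae_eq_of_forall_setLIntegral_eq_of_sigmaFinite
    (measurable_futureMorph κ L (measurableSet_singleton y))
    ((hg L y).comp ((hη.comp measurable_fst).prodMk measurable_snd)) fun D hD _ => ?_
  rw [← hκ.measure_eq_setLIntegral_futureMorph μ L (measurableSet_singleton y) hD, H L y D hD]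

/-- Under a nondegenerate input process, a prescient rival refines the causal-state partition. -/
theorem IsPrescient.refinesCausalStatesAE [Countable X] [DiscreteMeasurableSpace X] {κ : Kernel (ℤ → X) (ℤ → Y)} [IsMarkovKernel κ]
    (hκ : IsCausal κ) {μ : Measure (ℤ → X)} [IsProbabilityMeasure μ] {η : JointPast X Y → S}
    (hη : Measurable η) (hμ : IsNondegenerateInput μ) (h : IsPrescient κ μ η) :
    RefinesCausalStatesAE κ μ η := by
  obtain ⟨g, hg⟩ := h.exists_ae_futureMorph_eq hκ hη
  have : IsProbabilityMeasure (μ.map future) :=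
    Measure.isProbabilityMeasure_map measurable_future.aemeasurable
  -- Under the product law the null set of bad futures is measured by the same law for every joint
  -- past, so two pasts can be compared along one future.
  have hae := Measure.ae_ae_of_ae_prod ((hκ.prod_jointPast_future_ac hμ.prod_ac).ae_le hg)
  refine ⟨_, ae_iff.1 hae, fun s => ?_⟩
  simp only [Set.mem_ofPred_eq, not_not]
  by_cases hs : ∃ z, η z = s ∧ ∀ᵐ u ∂(μ.map future), ∀ (L : ℕ) (y : Fin L → Y),
      futureMorph κ z L (fun i => u i) {y} = g L y (η z, u)
  · obtain ⟨z, hzs, hz⟩ := hs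
    refine ⟨epsilonMap κ z, fun z' hz' hzs' => Quotient.sound fun L w => ?_⟩
    -- Both sets of bad futures are null while the cylinder of `w` is not, so a common good `u`
    -- begins with `w`.
    have hw : ∃ u : ℕ → X, (∀ (L : ℕ) (y : Fin L → Y),
          futureMorph κ z L (fun i => u i) {y} = g L y (η z, u)) ∧
        (∀ (L : ℕ) (y : Fin L → Y),
          futureMorph κ z' L (fun i => u i) {y} = g L y (η z', u)) ∧
        (fun i : Fin L => u i) = w := by
      by_contra hcon
      push Not at hcon
      have h0 : ∀ᵐ u ∂(μ.map future), (fun i : Fin L => u i) ≠ w := by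
        filter_upwards [hz, hz'] with u h1 h2 using hcon u h1 h2
      have h0' := ae_of_ae_map measurable_future.aemeasurable h0
      rw [ae_iff] at h0'
      simp only [not_not, ← window_zero_eq] at h0'
      exact (hμ.word_pos L w).ne' h0'
    obtain ⟨u, h1, h2, rfl⟩ := hw
    exact Measure.ext_of_singleton fun y => by rw [h1, h2, hzs, hzs']
  -- The fibre of `s` lies wholly in the exceptional set; any causal state will do.
  · obtain ⟨z⟩ : Nonempty (JointPast X Y) := inferInstance
    exact ⟨epsilonMap κ z, fun z' hz' hzs' => absurd ⟨z', hzs', hz'⟩ hs⟩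

end Refinement

end Transducer

theorem mainTheorem4 {X Y : Type*} [MeasurableSpace X] [MeasurableSpace Y]
    [Countable X] [Countable Y] [DiscreteMeasurableSpace X] [DiscreteMeasurableSpace Y]
    [Nonempty X] [Nonempty Y] (κ : Kernel (ℤ → X) (ℤ → Y)) [IsMarkovKernel κ]
    (hκ : Transducer.IsCausal κ) {S : Type*} [MeasurableSpace S]
    (η : Transducer.JointPast X Y → S) (hη : Measurable η) :
    (∀ (μ : Measure (ℤ → X)) [IsProbabilityMeasure μ], Transducer.IsNondegenerateInput μ →
        Transducer.IsPrescient κ μ η → Transducer.RefinesCausalStatesAE κ μ η) ∧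
      ((∀ (μ : Measure (ℤ → X)) [IsProbabilityMeasure μ], Transducer.IsPrescient κ μ η) →
        ∀ (μ : Measure (ℤ → X)) [IsProbabilityMeasure μ],
          Transducer.RefinesCausalStatesAE κ μ η) := by
  refine ⟨fun μ _ hμ h => h.refinesCausalStatesAE hκ hη hμ, fun h μ _ => ?_⟩
  obtain ⟨ν, hν, hnd, hpast⟩ := Transducer.exists_isNondegenerateInput_map_past_eq μ
  obtain ⟨N, hN, hs⟩ := (h ν).refinesCausalStatesAE hκ hη hnd
  refine ⟨N, ?_, hs⟩
  -- The containment in causal states involves no input process; only the nullity of `N` must pass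
  -- from `ν` to `μ`, and their input pasts have the same law.
  rwa [hκ.map_jointPast, ← hpast, ← hκ.map_jointPast]
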